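/- Let $n\ge 0$, $N\ge 1$, and let $U=[U_1,\dots,U_N]$ be a column permutation of the identity matrix of order $n$, split into submatrices $U_i\in\mathbb{R}^{n\times n_i}$ with $\sum_i n_i=n$. Let $f,\phi:\mathbb{R}^n\to\mathbb{R}$, put $F=f+\phi$, and for $x\in\mathbb{R}^n$ let $\phi_i^x(z)=\phi(x+U_i(z-U_i^Tx))$, $z\in\mathbb{R}^{n_i}$. For a symmetric positive definite matrix $D$ let $\|v\|_D=\sqrt{\langle v,Dv\rangle}$ and $\mathrm{prox}^D_{\alpha g}(x)=\operatorname{argmin}_y \frac12\|y-x\|_D^2+\alpha g(y)$. Assume: 1. $f$ is continuously differentiable, $\phi_i^x$ is convex for all $x\in\mathbb{R}^n$ and $i=1,\dots,N$, and $F$ is bounded from below; 2. $\nabla f$ is Lipschitz continuous on $\mathbb{R}^n$; 3. $\phi$ is continuously differentiable and $\nabla\phi$ is Lipschitz continuous on every compact subset of $\mathbb{R}^n$. Block-PHILA. Fix $0<\alpha_{\min}\le\alpha_{\max}$, $\beta_{\max}>0$, $\mu>0$, $\tau\ge0$, $\gamma>0$, $\delta,\sigma\in(0,1)$ and $x_0=x_{-1}=\dots=x_{-N}\in\mathbb{R}^n$.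 For $k=0,1,2,\dots$ let $i=i_k=(k \bmod N)+1$, choose $\alpha_k\in[\alpha_{\min},\alpha_{\max}]$, $\beta_k\in[0,\beta_{\max}]$ and a symmetric positive definite $D_k\in\mathbb{R}^{n_i\times n_i}$ with $\frac1\mu I\preceq D_k\preceq\mu I$, and let $$h_k(y)=\Big\langle U_i^T\nabla f(x_k)-\tfrac{\beta_k}{\alpha_k}D_kU_i^T(x_k-x_{k-N}),\,y-U_i^Tx_k\Big\rangle+\tfrac1{2\alpha_k}\|y-U_i^Tx_k\|_{D_k}^2+\phi_i^{x_k}(y)-\phi_i^{x_k}(U_i^Tx_k).$$ Take any $\tilde y_k\in\mathbb{R}^{n_i}$ with $h_k(\tilde y_k)\le\frac{2}{2+\tau}h_k(\hat y_k)$, where $\hat y_k=\mathrm{prox}^{D_k}_{\alpha_k\phi_i^{x_k}}\big(U_i^T(x_k+\beta_k(x_k-x_{k-N}))-\alpha_kD_k^{-1}U_i^T\nabla f(x_k)\big)$. Put $d_k=\tilde y_k-U_i^Tx_k$, let $m_k$ be the smallest non-negative integer with $$F(x_k+\delta^{m_k}U_id_k)+\tfrac\gamma2\|\delta^{m_k}d_k\|^2\le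 F(x_k)+\tfrac\gamma2\|U_i^T(x_k-x_{k-N})\|^2+\sigma\delta^{m_k}h_k(\tilde y_k),$$ and put $\lambda_k=\delta^{m_k}$. Set $x_{k+1}=x_k+U_id_k$ if $F(x_k+U_id_k)+\frac\gamma2\|d_k\|^2<F(x_k+\lambda_kU_id_k)+\frac\gamma2\lambda_k^2\|d_k\|^2$, and $x_{k+1}=x_k+\lambda_kU_id_k$ otherwise. KL functions. A continuously differentiable function $G$ on a Euclidean space is a Kurdyka–Łojasiewicz function if for every point $x^*$ there are $\nu>0$, a neighbourhood $W$ of $x^*$ and a continuous concave function $\xi:[0,\nu)\to[0,\infty)$ with $\xi(0)=0$, $\xi\in C^1((0,\nu))$ and $\xi'>0$ on $(0,\nu)$, such that $\xi'(G(x)-G(x^*))\,\|\nabla G(x)\|\ge1$ for all $x\in W$ with $G(x^*)<G(x)<G(x^*)+\nu$. Theorem. Let $\{x_k\}_{k\in\mathbb{N}}$ be a sequence generated by Block-PHILA. If $\{x_k\}_{k\in\mathbb{N}}$ is bounded and $\mathcal{F}:\mathbb{R}^n\times\mathbb{R}\to\mathbb{R}$, $\mathcal{F}(x,\rho)=F(x)+\frac12\rho^2$,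 is a Kurdyka–Łojasiewicz function, then $\{x_k\}_{k\in\mathbb{N}}$ converges to a point $x^*\in\mathbb{R}^n$ with $\nabla F(x^*)=0$. -/

import Mathlib

open Set Filter Topology
open scoped Matrix InnerProductSpace

noncomputable section

namespace BlockPHILA

/-- `ℝⁿ` with the Euclidean norm. -/
abbrev E (n : ℕ) : Type := EuclideanSpace ℝ (Fin n)

/-- The product `A x` of a real matrix and a vector, as a vector of a Euclidean space. -/
def act {m n : ℕ} (A : Matrix (Fin m) (Fin n) ℝ) (x : E n) : E m :=
  WithLp.toLp 2 (A *ᵥ x.ofLp)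

/-- The norm `‖x‖_D = √⟨x, D x⟩` induced by a symmetric positive definite matrix `D`. -/
def normD {n : ℕ} (D : Matrix (Fin n) (Fin n) ℝ) (x : E n) : ℝ :=
  √(⟪x, act D x⟫_ℝ)

/-- A decomposition `U = [U₁, …, U_N]` of a column permutation `U` of the identity matrix of
order `n` into `N` submatrices: the `s`-th column of `U_i` is the column of the identity with
index `perm ⟨i, s⟩`, and `U_i` has `size i` columns. -/
structure BlockDecomposition (n N : ℕ) where
  /-- The number `n_i` of columns of `U_i`. -/
  size : Fin N → ℕ
  /-- The column permutation; the columns are labelled by block and position in the block. -/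
  perm : (Σ i : Fin N, Fin (size i)) ≃ Fin n

/-- The matrix `U_i ∈ ℝ^{n × n_i}`. -/
def BlockDecomposition.U {n N : ℕ} (b : BlockDecomposition n N) (i : Fin N) :
    Matrix (Fin n) (Fin (b.size i)) ℝ :=
  (1 : Matrix (Fin n) (Fin n) ℝ).submatrix id (fun s => b.perm ⟨i, s⟩)

/-- The block restriction `φ_i^x (z) = φ (x + U_i (z - U_iᵀ x))`. -/
def blockFun {n N : ℕ} (b : BlockDecomposition n N) (φ : E n → ℝ) (i : Fin N) (x : E n)
    (z : E (b.size i)) : ℝ :=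
  φ (x + act (b.U i) (z - act (b.U i)ᵀ x))

/-- First group of assumptions on `f` and `φ`, for the block decomposition `b`: `f` is `C¹`, `φ` is
convex along the blocks of coordinates, and `f + φ` is bounded from below. -/
structure Assumption1 {n N : ℕ} (b : BlockDecomposition n N) (f φ : E n → ℝ) : Prop where
  contDiff_f : ContDiff ℝ 1 f
  convex_blocks : ∀ (x : E n) (i : Fin N), ConvexOn ℝ univ (blockFun b φ i x)
  bounded_below : ∃ Flow : ℝ, ∀ x, Flow ≤ f x + φ x

/-- `∇f` is globally Lipschitz continuous. -/
def Assumption2 {n : ℕ} (f : E n → ℝ) : Prop :=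
  ∃ L : ℝ, 0 < L ∧ ∀ x y, ‖gradient f x - gradient f y‖ ≤ L * ‖x - y‖

/-- `φ` is `C¹` and `∇φ` is Lipschitz continuous on every compact set. -/
structure Assumption3 {n : ℕ} (φ : E n → ℝ) : Prop where
  contDiff_phi : ContDiff ℝ 1 φ
  locally_lipschitz : ∀ K : Set (E n), IsCompact K →
    ∃ L : ℝ, 0 < L ∧ ∀ x ∈ K, ∀ y ∈ K, ‖gradient φ x - gradient φ y‖ ≤ L * ‖x - y‖

/-- The proximal operator of `α g` in the norm induced by `D`, as a set-valued map. -/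
def prox {m : ℕ} (g : E m → ℝ) (α : ℝ) (D : Matrix (Fin m) (Fin m) ℝ) (x : E m) : Set (E m) :=
  {y | ∀ z, 1 / 2 * normD D (y - x) ^ 2 + α * g y ≤ 1 / 2 * normD D (z - x) ^ 2 + α * g z}

/-- The user-chosen parameters of the algorithm, with their admissible ranges. -/
structure Params where
  αmin : ℝ
  αmax : ℝ
  βmax : ℝ
  μ : ℝ
  τ : ℝ
  γ : ℝ
  δ : ℝ
  σ : ℝ
  αmin_pos : 0 < αmin
  αmin_le : αmin ≤ αmax
  βmax_pos : 0 < βmax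
  μ_pos : 0 < μ
  τ_nonneg : 0 ≤ τ
  γ_pos : 0 < γ
  δ_mem : δ ∈ Ioo (0 : ℝ) 1
  σ_mem : σ ∈ Ioo (0 : ℝ) 1

section Iteration

variable {n N : ℕ} (f φ : E n → ℝ) (b : BlockDecomposition n N) (i : Fin N)

/-- The function `h(y) = ⟨U_iᵀ∇f(x) - (β/α) D U_iᵀ(x - w), y - U_iᵀx⟩ + ‖y - U_iᵀx‖_D² / (2α)
+ φ_i^x(y) - φ_i^x(U_iᵀx)`, where `x` is the current iterate and `w` the iterate `N` steps back. -/
def h (α β : ℝ) (D : Matrix (Fin (b.size i)) (Fin (b.size i)) ℝ) (x w : E n)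
    (y : E (b.size i)) : ℝ :=
  ⟪act (b.U i)ᵀ (gradient f x) - (β / α) • act D (act (b.U i)ᵀ (x - w)),
      y - act (b.U i)ᵀ x⟫_ℝ
    + 1 / (2 * α) * normD D (y - act (b.U i)ᵀ x) ^ 2
    + blockFun b φ i x y - blockFun b φ i x (act (b.U i)ᵀ x)

/-- The point at which the block proximal operator is evaluated:
`U_iᵀ(x + β(x - w)) - α D⁻¹ U_iᵀ∇f(x)`. -/
def forwardPoint (α β : ℝ) (D : Matrix (Fin (b.size i)) (Fin (b.size i)) ℝ) (x w : E n) :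
    E (b.size i) :=
  act (b.U i)ᵀ (x + β • (x - w)) - α • act D⁻¹ (act (b.U i)ᵀ (gradient f x))

/-- The Armijo-like line-search condition with exponent `m`, direction `d` and `hval = h(ỹ)`. -/
def Armijo (p : Params) (x w : E n) (d : E (b.size i)) (hval : ℝ) (m : ℕ) : Prop :=
  (f (x + p.δ ^ m • act (b.U i) d) + φ (x + p.δ ^ m • act (b.U i) d))
      + p.γ / 2 * ‖p.δ ^ m • d‖ ^ 2
    ≤ (f x + φ x) + p.γ / 2 * ‖act (b.U i)ᵀ (x - w)‖ ^ 2 + p.σ * p.δ ^ m * hval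

/-- The next iterate, given the direction `d` and the line-search parameter `lam`. -/
def update (p : Params) (x : E n) (d : E (b.size i)) (lam : ℝ) : E n :=
  if (f (x + act (b.U i) d) + φ (x + act (b.U i) d)) + p.γ / 2 * ‖d‖ ^ 2
      < (f (x + lam • act (b.U i) d) + φ (x + lam • act (b.U i) d))
        + p.γ / 2 * lam ^ 2 * ‖d‖ ^ 2
  then x + act (b.U i) d
  else x + lam • act (b.U i) d

/-- One iteration of Block-PHILA on the block `i`, from the current iterate `x` and the iterate `w`
that lies `N` steps back, to `xnext`, with the choices `α`, `β`, `D`, the inexact proximal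
point `ytilde` and the line-search exponent `m`. -/
structure IsStep (p : Params) (x w : E n) (α β : ℝ)
    (D : Matrix (Fin (b.size i)) (Fin (b.size i)) ℝ) (ytilde : E (b.size i)) (m : ℕ)
    (xnext : E n) : Prop where
  α_mem : α ∈ Icc p.αmin p.αmax
  β_mem : β ∈ Icc 0 p.βmax
  D_posDef : D.PosDef
  D_lower : ∀ z : E (b.size i), 1 / p.μ * ⟪z, z⟫_ℝ ≤ ⟪act D z, z⟫_ℝ
  D_upper : ∀ z : E (b.size i), ⟪act D z, z⟫_ℝ ≤ p.μ * ⟪z, z⟫_ℝ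
  /-- `ytilde` is a `τ`-approximation of the exact inertial proximal-gradient point. -/
  ytilde_approx : ∃ yhat ∈ prox (blockFun b φ i x) α D (forwardPoint f b i α β D x w),
    h f φ b i α β D x w ytilde ≤ 2 / (2 + p.τ) * h f φ b i α β D x w yhat
  m_least : IsLeast
    {j : ℕ | Armijo f φ b i p x w (ytilde - act (b.U i)ᵀ x) (h f φ b i α β D x w ytilde) j} m
  xnext_eq : xnext = update f φ b i p x (ytilde - act (b.U i)ᵀ x) (p.δ ^ m)

end Iteration

/-- `x₀, x₁, …` is a sequence generated by Block-PHILA. The blocks are selected cyclically. The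
truncated subtraction `k - N` realizes the initialization `x₋₁ = … = x₋N = x₀`. -/
def IsGenerated {n N : ℕ} [NeZero N] (f φ : E n → ℝ) (b : BlockDecomposition n N) (p : Params)
    (x : ℕ → E n) : Prop :=
  ∀ k : ℕ, ∃ (α β : ℝ)
    (D : Matrix (Fin (b.size (Fin.ofNat N k))) (Fin (b.size (Fin.ofNat N k))) ℝ)
    (ytilde : E (b.size (Fin.ofNat N k))) (m : ℕ),
    IsStep f φ b (Fin.ofNat N k) p (x k) (x (k - N)) α β D ytilde m (x (k + 1))

section KL

variable {V : Type*} [NormedAddCommGroup V] [InnerProductSpace ℝ V] [CompleteSpace V]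

/-- The Kurdyka–Łojasiewicz inequality at `xs`, for a continuously differentiable function `G`. -/
def KLAt (G : V → ℝ) (xs : V) : Prop :=
  ∃ ν : ℝ, 0 < ν ∧ ∃ W ∈ 𝓝 xs, ∃ ξ : ℝ → ℝ,
    ContinuousOn ξ (Ico 0 ν) ∧ ConcaveOn ℝ (Ico 0 ν) ξ ∧ (∀ s ∈ Ico 0 ν, 0 ≤ ξ s) ∧
    ξ 0 = 0 ∧ ContDiffOn ℝ 1 ξ (Ioo 0 ν) ∧ (∀ s ∈ Ioo 0 ν, 0 < deriv ξ s) ∧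
    ∀ x ∈ W, G xs < G x → G x < G xs + ν → 1 ≤ deriv ξ (G x - G xs) * ‖gradient G x‖

/-- A (continuously differentiable) Kurdyka–Łojasiewicz function. -/
def IsKL (G : V → ℝ) : Prop :=
  ContDiff ℝ 1 G ∧ ∀ xs, KLAt G xs

end KL

/-- The surrogate `𝓕(x, ρ) = F(x) + ρ²/2` on `ℝⁿ × ℝ` with the Euclidean product norm. -/
def surrogate {n : ℕ} (F : E n → ℝ) (z : WithLp 2 (E n × ℝ)) : ℝ :=
  F z.fst + 1 / 2 * z.snd ^ 2

end BlockPHILA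

end

/-! The proof joins a descent estimate for a Lyapunov function to a Kurdyka–Łojasiewicz
finite-length argument.

Descent. The model `h` is strongly convex in the block variable, uniformly in the iteration, because
`D` is bounded below and `φ` is convex along blocks. So `-h` at the inexact point dominates the
squared displacements of both the inexact and the exact proximal points. The Armijo test passes
below a uniform threshold: the descent inequality handles `f`, convexity handles `φ`, and Young's
inequality absorbs the inertial term into the `γ` terms. Optimality of the exact point bounds the
gradient of the active block (`exists_decrease_and_gradient_bound`).

Lyapunov function. `F` alone need not decrease. Since blocks are cycled, a block displacement over
`N` iterations comes from a single step, so adding `γ/2` times the last `N` squared steps to `F`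
gives a nonincreasing quantity. It is the surrogate evaluated at the iterate and at a scalar `ρ`.
Over one cycle every block is active once, so the full gradient is controlled by a window of past
decreases (`exists_lyapunov`).

Finite length. The KL inequality at a cluster point makes the square roots of the decreases summable
(`summable_of_desingularization`). The iterates are therefore Cauchy, and the gradients along them
tend to zero (`exists_tendsto_of_isKL`). -/

namespace BlockPHILA

/-! ### Matrices acting on Euclidean vectors, and the metric of `D`. -/

section MatrixAction

variable {m n : ℕ}

lemma act_add (A : Matrix (Fin m) (Fin n) ℝ) (x y : E n) : act A (x + y) = act A x + act A y := by
  ext i; simp [act, Matrix.mulVec_add]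

lemma act_sub (A : Matrix (Fin m) (Fin n) ℝ) (x y : E n) : act A (x - y) = act A x - act A y := by
  ext i; simp [act, Matrix.mulVec_sub]

lemma act_smul (A : Matrix (Fin m) (Fin n) ℝ) (c : ℝ) (x : E n) :
    act A (c • x) = c • act A x := by
  ext i; simp [act, Matrix.mulVec_smul]

lemma act_zero (A : Matrix (Fin m) (Fin n) ℝ) : act A 0 = 0 := by
  ext i; simp [act]

lemma inner_act_left (A : Matrix (Fin m) (Fin n) ℝ) (x : E n) (y : E m) :
    ⟪act A x, y⟫_ℝ = ⟪x, act Aᵀ y⟫_ℝ := by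
  simp only [act, EuclideanSpace.inner_eq_star_dotProduct, star_trivial]
  rw [Matrix.dotProduct_mulVec, ← Matrix.mulVec_transpose, dotProduct_comm]

lemma act_act_inv {D : Matrix (Fin n) (Fin n) ℝ} (hD : D.PosDef) (x : E n) :
    act D (act D⁻¹ x) = x := by
  have hu : IsUnit D.det := (Matrix.isUnit_iff_isUnit_det D).1 hD.isUnit
  ext i
  simp [act, Matrix.mul_nonsing_inv D hu]

lemma inner_act_comm {D : Matrix (Fin n) (Fin n) ℝ} (hD : D.PosDef) (x y : E n) :
    ⟪act D x, y⟫_ℝ = ⟪x, act D y⟫_ℝ := by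
  have h : Dᵀ = D := by
    have := hD.isHermitian.eq
    rwa [Matrix.conjTranspose_eq_transpose_of_trivial] at this
  rw [inner_act_left, h]

/-- A symmetric matrix with `0 ≤ D ≤ μ I` has operator norm at most `μ`. -/
lemma norm_act_le {D : Matrix (Fin n) (Fin n) ℝ} (hD : D.PosDef) {μ : ℝ} (hμ : 0 < μ)
    (h0 : ∀ z : E n, 0 ≤ ⟪act D z, z⟫_ℝ) (h1 : ∀ z : E n, ⟪act D z, z⟫_ℝ ≤ μ * ⟪z, z⟫_ℝ)
    (v : E n) : ‖act D v‖ ≤ μ * ‖v‖ := by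
  -- Positivity of the form at `v - μ⁻¹ D v` gives `μ⁻¹‖Dv‖² ≤ μ‖v‖²`, with no spectral theory.
  set w : E n := μ⁻¹ • act D v with hw
  have e := h0 (v - w)
  have e1 : ⟪act D w, v⟫_ℝ = ⟪act D v, w⟫_ℝ := by
    rw [inner_act_comm hD, real_inner_comm]
  rw [act_sub, inner_sub_left, inner_sub_right, inner_sub_right, e1] at e
  have hv := h1 v
  have hw' := h1 w
  have e2 : ⟪act D v, w⟫_ℝ = μ⁻¹ * ‖act D v‖ ^ 2 := by
    rw [hw, inner_smul_right, real_inner_self_eq_norm_sq]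
  have e3 : μ * ⟪w, w⟫_ℝ = μ⁻¹ * ‖act D v‖ ^ 2 := by
    rw [hw, inner_smul_right, inner_smul_left, real_inner_self_eq_norm_sq]
    simp; field_simp
  rw [real_inner_self_eq_norm_sq] at hv
  have e4 : μ⁻¹ * ‖act D v‖ ^ 2 ≤ μ * ‖v‖ ^ 2 := by linarith
  have e5 : ‖act D v‖ ^ 2 ≤ (μ * ‖v‖) ^ 2 := by
    have := mul_le_mul_of_nonneg_left e4 hμ.le
    rw [← mul_assoc, mul_inv_cancel₀ hμ.ne', one_mul] at this
    linarith [this, (by ring : (μ * ‖v‖) ^ 2 = μ * (μ * ‖v‖ ^ 2))]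
  exact abs_le_of_sq_le_sq' e5 (by positivity) |>.2

lemma normD_sq {D : Matrix (Fin n) (Fin n) ℝ}
    (h0 : ∀ z : E n, 0 ≤ ⟪act D z, z⟫_ℝ) (x : E n) : normD D x ^ 2 = ⟪act D x, x⟫_ℝ := by
  rw [normD, Real.sq_sqrt, real_inner_comm]
  rw [real_inner_comm]; exact h0 x

end MatrixAction

/-! ### Orthogonality of the coordinate blocks. -/

section Blocks

variable {n N : ℕ} (b : BlockDecomposition n N)

lemma act_transpose_U_apply (i : Fin N) (x : E n) (s : Fin (b.size i)) :
    act (b.U i)ᵀ x s = x (b.perm ⟨i, s⟩) := by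
  simp [act, BlockDecomposition.U, Matrix.mulVec, dotProduct, Matrix.one_apply]

lemma act_transpose_U_act_U (i : Fin N) (d : E (b.size i)) :
    act (b.U i)ᵀ (act (b.U i) d) = d := by
  ext s
  rw [act_transpose_U_apply]
  simp [act, BlockDecomposition.U, Matrix.mulVec, dotProduct, Matrix.one_apply]

lemma act_transpose_U_act_U_of_ne {i j : Fin N} (hij : i ≠ j) (d : E (b.size j)) :
    act (b.U i)ᵀ (act (b.U j) d) = 0 := by
  ext s
  rw [act_transpose_U_apply]
  simp [act, BlockDecomposition.U, Matrix.mulVec, dotProduct, hij]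

lemma inner_act_U_left (i : Fin N) (d : E (b.size i)) (x : E n) :
    ⟪act (b.U i) d, x⟫_ℝ = ⟪d, act (b.U i)ᵀ x⟫_ℝ := inner_act_left _ _ _

lemma norm_act_U (i : Fin N) (d : E (b.size i)) : ‖act (b.U i) d‖ = ‖d‖ := by
  rw [← sq_eq_sq₀ (norm_nonneg _) (norm_nonneg _), ← real_inner_self_eq_norm_sq,
    ← real_inner_self_eq_norm_sq, inner_act_U_left, act_transpose_U_act_U]

lemma norm_sq_eq_sum_blocks (x : E n) : ‖x‖ ^ 2 = ∑ i, ‖act (b.U i)ᵀ x‖ ^ 2 := by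
  simp only [EuclideanSpace.norm_sq_eq, act_transpose_U_apply]
  rw [← b.perm.sum_comp, Fintype.sum_sigma]

lemma norm_act_transpose_U_le (i : Fin N) (x : E n) : ‖act (b.U i)ᵀ x‖ ≤ ‖x‖ := by
  rw [← sq_le_sq₀ (norm_nonneg _) (norm_nonneg _), norm_sq_eq_sum_blocks b x]
  exact Finset.single_le_sum (f := fun i => ‖act (b.U i)ᵀ x‖ ^ 2)
    (fun _ _ => sq_nonneg _) (Finset.mem_univ i)

lemma norm_le_sum_blocks (x : E n) : ‖x‖ ≤ ∑ i, ‖act (b.U i)ᵀ x‖ := by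
  rw [← sq_le_sq₀ (norm_nonneg _) (Finset.sum_nonneg fun _ _ => norm_nonneg _),
    norm_sq_eq_sum_blocks b x]
  exact Finset.sum_sq_le_sq_sum_of_nonneg fun _ _ => norm_nonneg _

end Blocks

/-! ### The descent inequality and the abstract KL summability principle. -/

section Analysis

lemma hasDerivAt_comp_line {n : ℕ} {f : E n → ℝ} (hf : ContDiff ℝ 1 f) (x w : E n) (t : ℝ) :
    HasDerivAt (fun t : ℝ => f (x + t • w)) ⟪gradient f (x + t • w), w⟫_ℝ t := by
  have h1 : HasFDerivAt f (InnerProductSpace.toDual ℝ (E n) (gradient f (x + t • w)))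
      (x + t • w) := ((hf.differentiable one_ne_zero) _).hasGradientAt.hasFDerivAt
  have h2 : HasDerivAt (fun t : ℝ => x + t • w) w t := by
    simpa using ((hasDerivAt_id t).smul_const w).const_add x
  exact h1.comp_hasDerivAt t h2

/-- The descent inequality for a function with Lipschitz continuous gradient. -/
lemma le_add_inner_gradient {n : ℕ} {f : E n → ℝ} (hf : ContDiff ℝ 1 f) {L : ℝ} (hL : 0 < L)
    (hlip : ∀ x y, ‖gradient f x - gradient f y‖ ≤ L * ‖x - y‖) (x w : E n) :
    f (x + w) ≤ f x + ⟪gradient f x, w⟫_ℝ + L * ‖w‖ ^ 2 := by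
  -- The mean value theorem suffices: it yields `L` in place of the sharp `L / 2`, which is harmless
  -- here.
  obtain ⟨c, hc, h⟩ := exists_hasDerivAt_eq_slope (fun t : ℝ => f (x + t • w))
    (fun t => ⟪gradient f (x + t • w), w⟫_ℝ) zero_lt_one
    (fun t _ => (hasDerivAt_comp_line hf x w t).continuousAt.continuousWithinAt)
    (fun t _ => hasDerivAt_comp_line hf x w t)
  simp only [one_smul, zero_smul, add_zero, sub_zero, div_one] at h
  have h1 : ⟪gradient f (x + c • w) - gradient f x, w⟫_ℝ ≤ L * ‖w‖ ^ 2 := by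
    refine (real_inner_le_norm _ _).trans ?_
    have h2 := hlip (x + c • w) x
    rw [add_sub_cancel_left, norm_smul, Real.norm_eq_abs, abs_of_pos hc.1] at h2
    have h3 : L * (c * ‖w‖) ≤ L * ‖w‖ :=
      mul_le_mul_of_nonneg_left (mul_le_of_le_one_left (norm_nonneg _) hc.2.le) hL.le
    calc _ ≤ L * ‖w‖ * ‖w‖ := mul_le_mul_of_nonneg_right (h2.trans h3) (norm_nonneg _)
      _ = _ := by ring
  rw [inner_sub_left] at h1
  linarith

/-- A Kurdyka–Łojasiewicz convergence principle: if the decrease `r k - r (k + 1) = e k ^ 2`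
dominates the squared steps, and the desingularized slope near a cluster point `a` is bounded by
a window of past values of `e`, then the `e k` are summable. -/
lemma summable_of_desingularization {X : Type*} [PseudoMetricSpace X] {y : ℕ → X} {a : X}
    {r e : ℕ → ℝ} {ξ : ℝ → ℝ} {ν c C ε : ℝ} {M : ℕ} (hM : 0 < M) (hc : 0 ≤ c) (hC : 0 ≤ C)
    (hε : 0 < ε) (hν : 0 < ν)
    (ha : MapClusterPt a atTop y) (hr0 : ∀ k, 0 ≤ r k) (hr : Tendsto r atTop (𝓝 0))
    (he0 : ∀ k, 0 ≤ e k) (he : ∀ k, r k - r (k + 1) = e k ^ 2)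
    (hy : ∀ k, dist (y k) (y (k + 1)) ≤ c * e k)
    (hξc : ContinuousOn ξ (Ico 0 ν)) (hξ : ConcaveOn ℝ (Ico 0 ν) ξ)
    (hξ0 : ∀ s ∈ Ico 0 ν, 0 ≤ ξ s) (hξz : ξ 0 = 0) (hξd : DifferentiableOn ℝ ξ (Ioo 0 ν))
    (hξpos : ∀ s ∈ Ioo 0 ν, 0 < deriv ξ s)
    (hKL : ∀ᶠ k in atTop, dist (y (k + M)) a < ε → r (k + M) ∈ Ioo 0 ν →
      1 ≤ deriv ξ (r (k + M)) * (C * ∑ j ∈ Finset.range M, e (k + j))) :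
    Summable e := by
  have he' : Tendsto e atTop (𝓝 0) := by
    have h1 : Tendsto (fun k => e k ^ 2) atTop (𝓝 0) := by
      have := hr.sub (hr.comp (tendsto_add_atTop_nat 1))
      simpa [he] using this
    have h2 := h1.sqrt
    simpa [Real.sqrt_sq (he0 _)] using h2
  have hξt : Tendsto (fun k => ξ (r k)) atTop (𝓝 0) := by
    have h1 := hξc 0 ⟨le_rfl, hν⟩
    rw [ContinuousWithinAt, hξz] at h1
    refine h1.comp (tendsto_nhdsWithin_iff.2 ⟨hr, ?_⟩)
    filter_upwards [hr.eventually (gt_mem_nhds hν)] with k hk using ⟨hr0 k, hk⟩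
  -- the one-step inequality
  have key : ∀ᶠ k in atTop, dist (y (k + M)) a < ε →
      e (k + M) ≤ (∑ j ∈ Finset.range M, e (k + j)) / (2 * M)
        + C * M * (ξ (r (k + M)) - ξ (r (k + M + 1))) := by
    have hν' := (tendsto_add_atTop_nat M).eventually (hr.eventually (gt_mem_nhds hν))
    filter_upwards [hKL, hν'] with k hk hkν hd
    set W := ∑ j ∈ Finset.range M, e (k + j) with hW
    have hW0 : 0 ≤ W := Finset.sum_nonneg fun _ _ => he0 _
    have hM' : (0 : ℝ) < M := by exact_mod_cast hM
    have hstep := he (k + M)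
    have hle : r (k + M + 1) ≤ r (k + M) := by linarith [sq_nonneg (e (k + M))]
    -- The KL inequality says nothing once `r` vanishes, but then the decrease, hence `e`, vanishes
    -- too.
    rcases (hr0 (k + M)).eq_or_lt with h0 | h0
    · have h1 : r (k + M + 1) = 0 := le_antisymm (by linarith) (hr0 _)
      have h2 : e (k + M) = 0 := by
        rw [h1, ← h0] at hstep
        exact pow_eq_zero_iff two_ne_zero |>.1 (by linarith)
      rw [h2, h1, ← h0]
      simp; positivity
    · have hmem : r (k + M) ∈ Ioo 0 ν := ⟨h0, hkν⟩
      have h1 := hk hd hmem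
      have hconc : deriv ξ (r (k + M)) * e (k + M) ^ 2 ≤ ξ (r (k + M)) - ξ (r (k + M + 1)) := by
        rcases hle.eq_or_lt with h2 | h2
        · have : e (k + M) ^ 2 = 0 := by linarith
          simp [h2, this]
        · have hdiff : DifferentiableAt ℝ ξ (r (k + M)) :=
            hξd.differentiableAt (Ioo_mem_nhds hmem.1 hmem.2)
          have h3 := hξ.deriv_le_slope (x := r (k + M + 1)) (y := r (k + M))
            ⟨hr0 _, h2.trans hkν⟩ ⟨h0.le, hkν⟩ h2 hdiff
          rw [slope_def_field, le_div_iff₀ (by linarith)] at h3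
          rw [← hstep]; linarith
      have h4 : e (k + M) ^ 2 ≤ C * W * (ξ (r (k + M)) - ξ (r (k + M + 1))) := by
        calc e (k + M) ^ 2 ≤ deriv ξ (r (k + M)) * (C * W) * e (k + M) ^ 2 :=
              le_mul_of_one_le_left (sq_nonneg _) h1
          _ = C * W * (deriv ξ (r (k + M)) * e (k + M) ^ 2) := by ring
          _ ≤ _ := mul_le_mul_of_nonneg_left hconc (by positivity)
      set Δ := ξ (r (k + M)) - ξ (r (k + M + 1)) with hΔ
      have hΔ0 : 0 ≤ Δ :=
        (mul_nonneg (hξpos _ hmem).le (sq_nonneg _)).trans hconc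
      -- AM–GM weighted by `M`: the factor `1 / (2 * M)` ensures that the `M` overlapping windows,
      -- once summed, cost only half of the total and can be absorbed.
      refine abs_le_of_sq_le_sq' (h4.trans ?_) (by positivity) |>.2
      have h5 : (W / (2 * M) + C * M * Δ) ^ 2 = (W / (2 * M) - C * M * Δ) ^ 2 + 2 * (C * W * Δ) := by
        field_simp; ring
      rw [h5]
      have : 0 ≤ C * W * Δ := by positivity
      nlinarith [sq_nonneg (W / (2 * M) - C * M * Δ)]
  set ψ := fun k => ξ (r (k + M)) with hψ
  set B := fun k => ∑ j ∈ Finset.range M, e (k + j) + 2 * C * M * ψ k with hB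
  have hBt : Tendsto (fun k => c * B k) atTop (𝓝 0) := by
    have h1 : Tendsto (fun k => ∑ j ∈ Finset.range M, e (k + j)) atTop (𝓝 0) := by
      simpa using tendsto_finsetSum (Finset.range M)
        fun j _ => he'.comp (tendsto_add_atTop_nat j)
    have h2 : Tendsto ψ atTop (𝓝 0) := hξt.comp (tendsto_add_atTop_nat M)
    simpa using (h1.add (h2.const_mul (2 * C * M))).const_mul c
  obtain ⟨K₀, hK₀⟩ := eventually_atTop.1
    ((key.and (hBt.eventually (gt_mem_nhds (half_pos hε)))).and
      ((tendsto_add_atTop_nat M).eventually (hr.eventually (gt_mem_nhds hν))))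
  -- Start where the sequence is within `ε / 2` of `a` and the length budget `c * B K` is also below
  -- `ε / 2`.
  obtain ⟨K', hK', hdist⟩ := frequently_atTop.1
    (ha.frequently (Metric.ball_mem_nhds a (half_pos hε))) (K₀ + M)
  obtain ⟨K, rfl⟩ := Nat.exists_eq_add_of_le' (le_trans (Nat.le_add_left M K₀) hK' : M ≤ K')
  have hKK : K₀ ≤ K := by omega
  have hψ0 : ∀ t, 0 ≤ ψ (K + t) := fun t =>
    hξ0 _ ⟨hr0 _, (hK₀ (K + t) (by omega)).2⟩
  have hM' : (0 : ℝ) < M := by exact_mod_cast hM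
  have hsum : ∀ T, (∀ t < T, dist (y (K + t + M)) a < ε) →
      ∑ t ∈ Finset.range T, e (K + t + M) ≤ B K := by
    intro T hT
    have h1 : ∑ t ∈ Finset.range T, e (K + t + M) ≤ ∑ t ∈ Finset.range T,
        ((∑ j ∈ Finset.range M, e (K + t + j)) / (2 * M)
          + C * M * (ψ (K + t) - ψ (K + (t + 1)))) := by
      refine Finset.sum_le_sum fun t ht => ?_
      have h2 := (hK₀ (K + t) (by omega)).1.1 (hT t (Finset.mem_range.1 ht))
      have h3 : ψ (K + (t + 1)) = ξ (r (K + t + M + 1)) := by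
        simp only [hψ]; congr 2; omega
      rw [h3]; exact h2
    rw [Finset.sum_add_distrib, ← Finset.sum_div, ← Finset.mul_sum,
      Finset.sum_range_sub' (fun t => ψ (K + t)), Finset.sum_comm] at h1
    -- Each of the `M` shifted sums runs over indices inside one interval of length `M + T`.
    have h2 : ∑ j ∈ Finset.range M, ∑ t ∈ Finset.range T, e (K + t + j) ≤
        M * (∑ j ∈ Finset.range M, e (K + j) + ∑ t ∈ Finset.range T, e (K + t + M)) := by
      have h3 : ∀ j ∈ Finset.range M, ∑ t ∈ Finset.range T, e (K + t + j) ≤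
          ∑ j ∈ Finset.range M, e (K + j) + ∑ t ∈ Finset.range T, e (K + t + M) := by
        intro j hj
        have h4 : ∑ j ∈ Finset.range M, e (K + j) + ∑ t ∈ Finset.range T, e (K + t + M)
            = ∑ i ∈ Finset.range (M + T), e (K + i) := by
          rw [Finset.sum_range_add]
          congr 1
          exact Finset.sum_congr rfl fun t _ => by congr 1; omega
        have h5 : ∑ t ∈ Finset.range T, e (K + t + j) =
            ∑ i ∈ Finset.Ico j (T + j), e (K + i) := by
          rw [Finset.sum_Ico_eq_sum_range, Nat.add_sub_cancel]
          exact Finset.sum_congr rfl fun t _ => by congr 1; omega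
        rw [h4, h5]
        refine Finset.sum_le_sum_of_subset_of_nonneg (fun i hi => ?_) fun _ _ _ => he0 _
        rw [Finset.mem_Ico] at hi
        rw [Finset.mem_range] at hj ⊢
        omega
      simpa only [Finset.card_range, nsmul_eq_mul] using Finset.sum_le_card_nsmul _ _ _ h3
    have h6 : (∑ j ∈ Finset.range M, ∑ t ∈ Finset.range T, e (K + t + j)) / (2 * M) ≤
        (∑ j ∈ Finset.range M, e (K + j) + ∑ t ∈ Finset.range T, e (K + t + M)) / 2 := by
      rw [div_le_iff₀ (by positivity)]
      linarith
    have h7 : 0 ≤ C * M * ψ (K + T) := by have := hψ0 T; positivity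
    simp only [hB, add_zero] at h1 ⊢
    linarith
  -- Bootstrap: while the earlier points lie in the ball, the length bound holds and keeps the next
  -- point inside.
  have htrap : ∀ T, dist (y (K + T + M)) a < ε := by
    intro T
    induction T using Nat.strong_induction_on with
    | _ T ih =>
      have h1 := hsum T ih
      have h2 : dist (y (K + M)) (y (K + T + M)) ≤ ∑ t ∈ Finset.range T, c * e (K + t + M) := by
        have h3 := dist_le_range_sum_of_dist_le (f := fun t => y (K + t + M))
          (d := fun t => c * e (K + t + M)) T (fun {t} _ => by
            have := hy (K + t + M)
            rwa [show K + t + M + 1 = K + (t + 1) + M by omega] at this)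
        simpa using h3
      rw [← Finset.mul_sum] at h2
      have h4 := mul_le_mul_of_nonneg_left h1 hc
      have h5 := (hK₀ K hKK).1.2
      have h6 : dist (y (K + M)) a < ε / 2 := hdist
      have h7 := dist_triangle_left (y (K + T + M)) a (y (K + M))
      linarith
  have hs : Summable fun t => e (t + (K + M)) := by
    refine summable_of_sum_range_le (c := B K) (fun _ => he0 _) fun T => ?_
    refine le_trans (le_of_eq (Finset.sum_congr rfl fun t _ => ?_)) (hsum T fun t _ => htrap t)
    congr 1; omega
  exact (summable_nat_add_iff (K + M)).1 hs

end Analysis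

/-! ### One iteration: sufficient decrease and block optimality. -/

section Step

variable {n N : ℕ} {f φ : E n → ℝ} {b : BlockDecomposition n N} {i : Fin N} {α β : ℝ}
  {D : Matrix (Fin (b.size i)) (Fin (b.size i)) ℝ} {x w : E n}

lemma h_eq (h0 : ∀ z, 0 ≤ ⟪act D z, z⟫_ℝ) (y : E (b.size i)) :
    h f φ b i α β D x w y =
      ⟪act (b.U i)ᵀ (gradient f x), y - act (b.U i)ᵀ x⟫_ℝ
        - β / α * ⟪act D (act (b.U i)ᵀ (x - w)), y - act (b.U i)ᵀ x⟫_ℝ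
        + 1 / (2 * α) * ⟪act D (y - act (b.U i)ᵀ x), y - act (b.U i)ᵀ x⟫_ℝ
        + φ (x + act (b.U i) (y - act (b.U i)ᵀ x)) - φ x := by
  simp [h, blockFun, normD_sq h0, inner_sub_left (𝕜 := ℝ) (act (b.U i)ᵀ (gradient f x)),
    inner_smul_left, act_zero]

lemma h_self (h0 : ∀ z, 0 ≤ ⟪act D z, z⟫_ℝ) :
    h f φ b i α β D x w (act (b.U i)ᵀ x) = 0 := by
  simp [h_eq h0, act_zero]

/-- The inertial proximal-gradient point minimizes `h`. -/
lemma h_le_of_mem_prox (hα : 0 < α) (hD : D.PosDef) (h0 : ∀ z, 0 ≤ ⟪act D z, z⟫_ℝ)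
    {yhat : E (b.size i)}
    (hy : yhat ∈ prox (blockFun b φ i x) α D (forwardPoint f b i α β D x w))
    (z : E (b.size i)) : h f φ b i α β D x w yhat ≤ h f φ b i α β D x w z := by
  -- The forward displacement. Completing the square turns the proximal objective into `α * h` plus
  -- a constant.
  set g : E (b.size i) :=
    β • act (b.U i)ᵀ (x - w) - α • act D⁻¹ (act (b.U i)ᵀ (gradient f x)) with hg
  have hDg : act D g = β • act D (act (b.U i)ᵀ (x - w)) - α • act (b.U i)ᵀ (gradient f x) := by
    rw [hg, act_sub, act_smul, act_smul, act_act_inv hD]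
  have key : ∀ y, 1 / 2 * normD D (y - forwardPoint f b i α β D x w) ^ 2
      + α * blockFun b φ i x y
      = α * (h f φ b i α β D x w y + φ x) + 1 / 2 * ⟪act D g, g⟫_ℝ := by
    intro y
    have e : y - forwardPoint f b i α β D x w = (y - act (b.U i)ᵀ x) - g := by
      rw [forwardPoint, act_add, act_smul, hg]; abel
    rw [normD_sq h0, e, h_eq h0, blockFun]
    set d := y - act (b.U i)ᵀ x
    have e2 : ⟪act D d, g⟫_ℝ = ⟪act D g, d⟫_ℝ := by
      rw [inner_act_comm hD, real_inner_comm]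
    have e3 : ⟪act D g, d⟫_ℝ = β * ⟪act D (act (b.U i)ᵀ (x - w)), d⟫_ℝ
        - α * ⟪act (b.U i)ᵀ (gradient f x), d⟫_ℝ := by
      rw [hDg, inner_sub_left, inner_smul_left, inner_smul_left]; simp
    clear_value d g
    rw [act_sub, inner_sub_left, inner_sub_right, inner_sub_right, e2, e3]
    field_simp
    ring
  have := hy z
  rw [key, key] at this
  have : α * h f φ b i α β D x w yhat ≤ α * h f φ b i α β D x w z := by linarith
  exact le_of_mul_le_mul_left this hα

/-- Quadratic growth of `h` at a minimizer. -/
lemma h_quadratic_growth (hα : 0 < α) {μ : ℝ} (hμ : 0 < μ)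
    (hD : D.PosDef) (h0 : ∀ z, 0 ≤ ⟪act D z, z⟫_ℝ)
    (hlow : ∀ z : E (b.size i), 1 / μ * ⟪z, z⟫_ℝ ≤ ⟪act D z, z⟫_ℝ)
    (hconv : ConvexOn ℝ univ (blockFun b φ i x)) {yhat : E (b.size i)}
    (hmin : ∀ z, h f φ b i α β D x w yhat ≤ h f φ b i α β D x w z) (y : E (b.size i)) :
    1 / (4 * α * μ) * ‖y - yhat‖ ^ 2 ≤ h f φ b i α β D x w y - h f φ b i α β D x w yhat := by
  set u := act (b.U i)ᵀ x with hu
  -- Testing minimality at the midpoint only gives half of the sharp growth constant, which is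
  -- enough.
  have h1 := hmin ((1 / 2 : ℝ) • yhat + (1 / 2 : ℝ) • y)
  have h2 := hconv.2 (mem_univ yhat) (mem_univ y)
    (by norm_num : (0 : ℝ) ≤ 1 / 2) (by norm_num : (0 : ℝ) ≤ 1 / 2) (by norm_num)
  simp only [blockFun, smul_eq_mul, ← hu] at h2
  rw [h_eq h0, h_eq h0] at h1 ⊢
  simp only [← hu] at h1 ⊢
  have e1 : (1 / 2 : ℝ) • yhat + (1 / 2 : ℝ) • y - u
      = (1 / 2 : ℝ) • ((yhat - u) + (y - u)) := by module
  have e2 : y - yhat = (y - u) - (yhat - u) := by abel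
  have h3 := hlow (y - yhat)
  rw [real_inner_self_eq_norm_sq] at h3
  have h4 : 1 / (4 * α) * (1 / μ * ‖y - yhat‖ ^ 2)
      ≤ 1 / (4 * α) * ⟪act D (y - yhat), y - yhat⟫_ℝ :=
    mul_le_mul_of_nonneg_left h3 (by positivity)
  have e4 : 1 / (4 * α) * (1 / μ * ‖y - yhat‖ ^ 2) = 1 / (4 * α * μ) * ‖y - yhat‖ ^ 2 := by
    field_simp
  rw [← e4]
  refine h4.trans ?_
  rw [e1] at h1 h2
  rw [e2]
  set a := yhat - u
  set c := y - u
  have e5 : ⟪act D c, a⟫_ℝ = ⟪act D a, c⟫_ℝ := by rw [inner_act_comm hD, real_inner_comm]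
  simp only [act_sub, act_smul D, act_add D, inner_smul_left, inner_smul_right, inner_sub_left,
    inner_sub_right, inner_add_right, inner_add_left, e5, conj_trivial] at h1 ⊢
  have e6 : 1 / (2 * α) = 2 * (1 / (4 * α)) := by field_simp; norm_num
  rw [e6] at h1 ⊢
  linarith

/-- First-order optimality of a minimizer of `h`, as a bound on the block gradient. -/
lemma norm_block_gradient_le (hα : 0 < α) (hβ : 0 ≤ β) {μ : ℝ} (hμ : 0 < μ)
    (hD : D.PosDef) (h0 : ∀ z, 0 ≤ ⟪act D z, z⟫_ℝ)
    (hup : ∀ z : E (b.size i), ⟪act D z, z⟫_ℝ ≤ μ * ⟪z, z⟫_ℝ)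
    (hφ : ContDiff ℝ 1 φ) {yhat : E (b.size i)}
    (hmin : ∀ z, h f φ b i α β D x w yhat ≤ h f φ b i α β D x w z) :
    ‖act (b.U i)ᵀ (gradient f x + gradient φ x)‖ ≤
      β / α * μ * ‖act (b.U i)ᵀ (x - w)‖ + 1 / α * μ * ‖yhat - act (b.U i)ᵀ x‖
        + ‖gradient φ (x + act (b.U i) (yhat - act (b.U i)ᵀ x)) - gradient φ x‖ := by
  set u := act (b.U i)ᵀ x with hu
  set q := act (b.U i)ᵀ (gradient f x) with hq
  set v := act (b.U i)ᵀ (x - w) with hv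
  set z := yhat - u with hz
  set G := gradient φ (x + act (b.U i) z) with hG
  -- The gradient of `h` at `yhat`; its derivative in its own direction is `‖r‖²`, so Fermat's rule
  -- forces `r = 0`.
  set r : E (b.size i) :=
    q - (β / α) • act D v + (1 / α) • act D z + act (b.U i)ᵀ G with hr
  have hr0 : r = 0 := by
    have hd : HasDerivAt (fun t : ℝ => h f φ b i α β D x w (yhat + t • r)) ⟪r, r⟫_ℝ 0 := by
      have e : (fun t : ℝ => h f φ b i α β D x w (yhat + t • r)) = fun t : ℝ =>
          (⟪q, z⟫_ℝ - β / α * ⟪act D v, z⟫_ℝ + 1 / (2 * α) * ⟪act D z, z⟫_ℝ - φ x)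
          + t * (⟪q, r⟫_ℝ - β / α * ⟪act D v, r⟫_ℝ + 1 / α * ⟪act D z, r⟫_ℝ)
          + t ^ 2 * (1 / (2 * α) * ⟪act D r, r⟫_ℝ)
          + φ ((x + act (b.U i) z) + t • act (b.U i) r) := by
        funext t
        rw [h_eq h0]
        simp only [← hu, ← hq, ← hv]
        have e1 : yhat + t • r - u = z + t • r := by rw [hz]; abel
        have e2 : ⟪act D r, z⟫_ℝ = ⟪act D z, r⟫_ℝ := by rw [inner_act_comm hD, real_inner_comm]
        rw [e1]
        simp only [act_add, act_smul, inner_add_left, inner_add_right, inner_smul_left,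
          inner_smul_right, conj_trivial, e2, add_assoc x]
        have e6 : 1 / α = 2 * (1 / (2 * α)) := by field_simp
        rw [e6]
        ring
      rw [e]
      have d1 := hasDerivAt_comp_line hφ (x + act (b.U i) z) (act (b.U i) r) 0
      have d2 := (hasDerivAt_id (0 : ℝ)).mul_const
        (⟪q, r⟫_ℝ - β / α * ⟪act D v, r⟫_ℝ + 1 / α * ⟪act D z, r⟫_ℝ)
      have d3 := (hasDerivAt_pow 2 (0 : ℝ)).mul_const (1 / (2 * α) * ⟪act D r, r⟫_ℝ)
      have d4 := (((hasDerivAt_const (0 : ℝ) (⟪q, z⟫_ℝ - β / α * ⟪act D v, z⟫_ℝ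
        + 1 / (2 * α) * ⟪act D z, z⟫_ℝ - φ x)).add d2).add d3).add d1
      refine d4.congr_deriv ?_
      simp only [zero_smul, add_zero, ← hG]
      rw [real_inner_comm (act (b.U i) r), inner_act_U_left, real_inner_comm _ r]
      conv_rhs => rw [hr, inner_add_left, inner_add_left, inner_sub_left, inner_smul_left,
        inner_smul_left]
      rw [← hr]
      simp
    have hm : IsLocalMin (fun t : ℝ => h f φ b i α β D x w (yhat + t • r)) 0 :=
      Eventually.of_forall fun t => by simpa using hmin (yhat + t • r)
    exact inner_self_eq_zero.1 (hm.hasDerivAt_eq_zero hd)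
  have e : act (b.U i)ᵀ (gradient f x + gradient φ x) =
      (β / α) • act D v - (1 / α) • act D z - act (b.U i)ᵀ (G - gradient φ x) := by
    have : r + ((β / α) • act D v - (1 / α) • act D z - act (b.U i)ᵀ G
      + act (b.U i)ᵀ (gradient φ x)) = q + act (b.U i)ᵀ (gradient φ x) := by rw [hr]; abel
    rw [hr0, zero_add] at this
    rw [act_add, ← hq, ← this, act_sub (b.U i)ᵀ G]; abel
  rw [e]
  have n1 := norm_act_le hD hμ h0 hup v
  have n2 := norm_act_le hD hμ h0 hup z
  have n3 := norm_act_transpose_U_le b i (G - gradient φ x)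
  refine (norm_sub_le _ _).trans (add_le_add ((norm_sub_le _ _).trans (add_le_add ?_ ?_)) n3)
  · rw [norm_smul, Real.norm_of_nonneg (by positivity), mul_assoc]
    exact mul_le_mul_of_nonneg_left n1 (by positivity)
  · rw [norm_smul, Real.norm_of_nonneg (by positivity), mul_assoc]
    exact mul_le_mul_of_nonneg_left n2 (by positivity)

/-- The line-search inequality holds for every sufficiently small step. -/
lemma armijo_of_small (p : Params) {L : ℝ} (hL : 0 < L) (hf : ContDiff ℝ 1 f)
    (hlip : ∀ x y, ‖gradient f x - gradient f y‖ ≤ L * ‖x - y‖)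
    (hconv : ConvexOn ℝ univ (blockFun b φ i x))
    (hα : α ∈ Icc p.αmin p.αmax) (hβ : β ∈ Icc 0 p.βmax) (hD : D.PosDef)
    (h0 : ∀ z, 0 ≤ ⟪act D z, z⟫_ℝ)
    (hup : ∀ z : E (b.size i), ⟪act D z, z⟫_ℝ ≤ p.μ * ⟪z, z⟫_ℝ) (y : E (b.size i))
    {l : ℝ} (hl : l ∈ Ioc (0 : ℝ) 1)
    (hsmall : (L + p.γ / 2 + (p.βmax / p.αmin * p.μ) ^ 2 / (2 * p.γ)) * l
        * ‖y - act (b.U i)ᵀ x‖ ^ 2 ≤ (1 - p.σ) * -h f φ b i α β D x w y) :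
    (f (x + l • act (b.U i) (y - act (b.U i)ᵀ x)) + φ (x + l • act (b.U i) (y - act (b.U i)ᵀ x)))
      + p.γ / 2 * ‖l • (y - act (b.U i)ᵀ x)‖ ^ 2
    ≤ (f x + φ x) + p.γ / 2 * ‖act (b.U i)ᵀ (x - w)‖ ^ 2
      + p.σ * l * h f φ b i α β D x w y := by
  have hα0 : 0 < α := p.αmin_pos.trans_le hα.1
  have hαm := p.αmin_pos
  have hγ := p.γ_pos
  have hμ := p.μ_pos
  have hβm := p.βmax_pos
  have hl0 := hl.1
  have hh := h_eq (f := f) (φ := φ) (α := α) (β := β) (x := x) (w := w) h0 y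
  set H := h f φ b i α β D x w y
  set u := act (b.U i)ᵀ x with hu
  set d := y - u with hd
  set v := act (b.U i)ᵀ (x - w) with hv
  set B := p.βmax / p.αmin * p.μ with hB
  have hB0 : 0 < B := by positivity
  -- the smooth part
  have h1 := le_add_inner_gradient hf hL hlip x (l • act (b.U i) d)
  rw [inner_smul_right, real_inner_comm, inner_act_U_left, real_inner_comm, norm_smul, norm_act_U,
    Real.norm_of_nonneg hl0.le] at h1
  -- the convex part
  have h2 := hconv.2 (mem_univ u) (mem_univ y) (sub_nonneg.2 hl.2) hl0.le (by ring)
  have e1 : (1 - l) • u + l • y - u = l • d := by rw [hd]; module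
  simp only [blockFun, smul_eq_mul, ← hu, e1, sub_self, act_zero, add_zero, act_smul] at h2
  rw [← hd] at h2
  -- the inertial part
  have h3 : β / α * ⟪act D v, d⟫_ℝ ≤ B * (‖v‖ * ‖d‖) := by
    have n1 := (real_inner_le_norm (act D v) d).trans
      (mul_le_mul_of_nonneg_right (norm_act_le hD hμ h0 hup v) (norm_nonneg d))
    have n2 : β / α ≤ p.βmax / p.αmin := by
      gcongr
      exacts [hβ.2, hα.1]
    calc _ ≤ β / α * (p.μ * ‖v‖ * ‖d‖) :=
          mul_le_mul_of_nonneg_left n1 (div_nonneg hβ.1 hα0.le)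
      _ ≤ p.βmax / p.αmin * (p.μ * ‖v‖ * ‖d‖) := mul_le_mul_of_nonneg_right n2 (by positivity)
      _ = _ := by rw [hB]; ring
  -- Young's inequality, weighted so that the `‖v‖²` part is exactly the slack granted by the line
  -- search.
  have h4 : l * (B * (‖v‖ * ‖d‖)) ≤ p.γ / 2 * ‖v‖ ^ 2 + B ^ 2 / (2 * p.γ) * (l ^ 2 * ‖d‖ ^ 2) := by
    have : p.γ / 2 * ‖v‖ ^ 2 + B ^ 2 / (2 * p.γ) * (l ^ 2 * ‖d‖ ^ 2) - l * (B * (‖v‖ * ‖d‖))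
        = 1 / (2 * p.γ) * (p.γ * ‖v‖ - B * l * ‖d‖) ^ 2 := by
      field_simp; ring
    have : 0 ≤ 1 / (2 * p.γ) * (p.γ * ‖v‖ - B * l * ‖d‖) ^ 2 := by positivity
    linarith
  have h5 : 0 ≤ 1 / (2 * α) * ⟪act D d, d⟫_ℝ := mul_nonneg (by positivity) (h0 d)
  rw [norm_smul, Real.norm_of_nonneg hl0.le]
  have h6 := mul_le_mul_of_nonneg_left h3 hl0.le
  have h7 := mul_nonneg hl0.le h5
  have h8 := mul_le_mul_of_nonneg_left hsmall hl0.le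
  have h9 : l * H = l * (⟪act (b.U i)ᵀ (gradient f x), d⟫_ℝ - β / α * ⟪act D v, d⟫_ℝ
    + 1 / (2 * α) * ⟪act D d, d⟫_ℝ + φ (x + act (b.U i) d) - φ x) := by rw [hh]
  nlinarith

/-- The data extracted from one iteration: a sufficient decrease and a bound on the block
gradient. -/
lemma exists_decrease_and_gradient_bound {p : Params} (a1 : Assumption1 b f φ) (a3 : Assumption3 φ)
    {L : ℝ} (hL : 0 < L) (hlip : ∀ x y, ‖gradient f x - gradient f y‖ ≤ L * ‖x - y‖) :
    ∃ a > 0, ∃ C > 0, ∀ (i : Fin N) (x w : E n) (α β : ℝ)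
      (D : Matrix (Fin (b.size i)) (Fin (b.size i)) ℝ) (ytilde : E (b.size i)) (m : ℕ)
      (xnext : E n), IsStep f φ b i p x w α β D ytilde m xnext →
      (∃ d, xnext = x + act (b.U i) d) ∧ ∃ z : E n,
        (f xnext + φ xnext) + p.γ / 2 * ‖xnext - x‖ ^ 2 + a * (‖xnext - x‖ ^ 2 + ‖z‖ ^ 2)
          ≤ (f x + φ x) + p.γ / 2 * ‖act (b.U i)ᵀ (x - w)‖ ^ 2 ∧
        ‖act (b.U i)ᵀ (gradient f x + gradient φ x)‖ ≤
          C * (‖act (b.U i)ᵀ (x - w)‖ + ‖z‖) + ‖gradient φ (x + z) - gradient φ x‖ := by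
  have hγ := p.γ_pos
  have hμ := p.μ_pos
  have hτ := p.τ_nonneg
  have hαm := p.αmin_pos
  have hαM : 0 < p.αmax := hαm.trans_le p.αmin_le
  have hβm := p.βmax_pos
  have hδ := p.δ_mem
  have hσ := p.σ_mem
  set c := 1 / (4 * p.αmax * p.μ) with hc
  have hc0 : 0 < c := by positivity
  -- Growth at `u` and at `ytilde`, with the `τ`-approximation, bounds the two squared displacements
  -- by `(3 + 5τ/2) / c` times `-Ht`; this is rounded up.
  set K := 3 * (1 + p.τ) / c with hK
  have hK0 : 0 < K := by positivity
  set C' := L + p.γ / 2 + (p.βmax / p.αmin * p.μ) ^ 2 / (2 * p.γ) with hC'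
  have hC'0 : 0 < C' := by positivity
  have hσ1 : 0 < 1 - p.σ := sub_pos.2 hσ.2
  set lbar := (1 - p.σ) / (C' * K) with hlbar
  have hlbar0 : 0 < lbar := by positivity
  set lmin := min 1 (p.δ * lbar) with hlmin
  have hlmin0 : 0 < lmin := lt_min one_pos (mul_pos hδ.1 hlbar0)
  refine ⟨p.σ * lmin / K, div_pos (mul_pos hσ.1 hlmin0) hK0,
    p.βmax / p.αmin * p.μ + 1 / p.αmin * p.μ, by positivity, ?_⟩
  intro i x w α β D ytilde m xnext hs
  have h0 : ∀ z, 0 ≤ ⟪act D z, z⟫_ℝ := fun z =>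
    (mul_nonneg (by positivity) real_inner_self_nonneg).trans (hs.D_lower z)
  have hα0 : 0 < α := hαm.trans_le hs.α_mem.1
  obtain ⟨yhat, hyhat, happ⟩ := hs.ytilde_approx
  have hmin := h_le_of_mem_prox hα0 hs.D_posDef h0 hyhat
  have hgrow : ∀ y, c * ‖y - yhat‖ ^ 2 ≤
      h f φ b i α β D x w y - h f φ b i α β D x w yhat := by
    intro y
    refine le_trans (mul_le_mul_of_nonneg_right ?_ (sq_nonneg _))
      (h_quadratic_growth hα0 hμ hs.D_posDef h0 hs.D_lower (a1.convex_blocks x i) hmin y)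
    rw [hc]
    have := hs.α_mem.2
    gcongr
  set u := act (b.U i)ᵀ x with hu
  set Ht := h f φ b i α β D x w ytilde with hHt
  set Hh := h f φ b i α β D x w yhat with hHh
  have hg1 := hgrow u
  rw [hu, h_self h0, ← hu] at hg1
  have hg2 := hgrow ytilde
  rw [← hHt] at hg2
  have hHh' : (2 + p.τ) * Ht ≤ 2 * Hh := by
    have : Ht ≤ 2 * Hh / (2 + p.τ) := happ.trans_eq (by ring)
    rw [le_div_iff₀ (by positivity)] at this
    linarith
  have hHh0 : Hh ≤ 0 := by nlinarith [mul_nonneg hc0.le (sq_nonneg ‖u - yhat‖)]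
  have hHt0 : Ht ≤ 0 := by nlinarith
  have hKb : ‖ytilde - u‖ ^ 2 + ‖yhat - u‖ ^ 2 ≤ K * -Ht := by
    rw [norm_sub_rev u yhat] at hg1
    have h1 : ‖ytilde - u‖ ≤ ‖ytilde - yhat‖ + ‖yhat - u‖ := norm_sub_le_norm_sub_add_norm_sub ..
    have h2 : ‖ytilde - u‖ ^ 2 ≤ 2 * ‖ytilde - yhat‖ ^ 2 + 2 * ‖yhat - u‖ ^ 2 := by
      nlinarith [norm_nonneg (ytilde - u), sq_nonneg (‖ytilde - yhat‖ - ‖yhat - u‖)]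
    have h3 : c * (‖ytilde - u‖ ^ 2 + ‖yhat - u‖ ^ 2) ≤ 3 * (1 + p.τ) * -Ht := by
      have := mul_le_mul_of_nonneg_left h2 hc0.le
      nlinarith
    rw [hK, div_mul_eq_mul_div, le_div_iff₀ hc0]
    linarith
  have hdb : ‖ytilde - u‖ ^ 2 ≤ K * -Ht := by linarith [sq_nonneg ‖yhat - u‖]
  -- lower bound for the line-search parameter
  have harm : ∀ l ∈ Ioc (0 : ℝ) 1, l ≤ lbar → _ := fun l hl hll =>
    armijo_of_small (w := w) p hL a1.contDiff_f hlip (a1.convex_blocks x i) hs.α_mem hs.β_mem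
      hs.D_posDef h0 hs.D_upper ytilde hl (by
        rw [← hC', ← hu, ← hHt]
        rw [hlbar, le_div_iff₀ (by positivity)] at hll
        have hl0 := hl.1
        calc C' * l * ‖ytilde - u‖ ^ 2 ≤ C' * l * (K * -Ht) :=
              mul_le_mul_of_nonneg_left hdb (by positivity)
          _ = (l * (C' * K)) * -Ht := by ring
          _ ≤ _ := mul_le_mul_of_nonneg_right hll (by linarith))
  have hlm : lmin ≤ p.δ ^ m := by
    rcases m with _ | m
    · simp [hlmin]
    -- The preceding trial step was rejected, so it exceeds `lbar`, and one backtrack loses only a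
    -- factor `δ`.
    · have h1 : ¬ p.δ ^ m ≤ lbar := fun hle => by
        have h2 := harm (p.δ ^ m) ⟨pow_pos hδ.1 m, pow_le_one₀ hδ.1.le hδ.2.le⟩ hle
        have := hs.m_least.2 (show m ∈ _ from h2)
        omega
      refine (min_le_right _ _).trans ?_
      rw [pow_succ']
      exact mul_le_mul_of_nonneg_left (not_le.1 h1).le hδ.1.le
  have hA : Armijo f φ b i p x w (ytilde - u) Ht m := hs.m_least.1
  rw [Armijo] at hA
  set l := p.δ ^ m with hl
  have hl0 : 0 < l := pow_pos hδ.1 m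
  have hl1 : l ≤ 1 := pow_le_one₀ hδ.1.le hδ.2.le
  set d := ytilde - u with hd
  have hn : (∃ d', xnext = x + act (b.U i) d') ∧ ‖xnext - x‖ ≤ ‖d‖ ∧
      (f xnext + φ xnext) + p.γ / 2 * ‖xnext - x‖ ^ 2 ≤
        (f x + φ x) + p.γ / 2 * ‖act (b.U i)ᵀ (x - w)‖ ^ 2 + p.σ * l * Ht := by
    have e1 : ‖l • d‖ = l * ‖d‖ := by rw [norm_smul, Real.norm_of_nonneg hl0.le]
    rw [e1, mul_pow] at hA
    rw [hs.xnext_eq, update]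
    -- The full step is taken only when its merit value is smaller, so it inherits the Armijo bound.
    split_ifs with hcase
    · refine ⟨⟨_, rfl⟩, by rw [add_sub_cancel_left, norm_act_U], ?_⟩
      · rw [add_sub_cancel_left, norm_act_U]
        linarith
    · refine ⟨⟨l • d, by rw [act_smul]⟩, ?_, ?_⟩
      · rw [add_sub_cancel_left, ← act_smul, norm_act_U, e1]
        exact mul_le_of_le_one_left (norm_nonneg _) hl1
      · rw [add_sub_cancel_left, ← act_smul, norm_act_U, e1, mul_pow, act_smul]
        exact hA
  -- The witness is the exact proximal displacement: optimality is available only there, not at the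
  -- inexact point.
  refine ⟨hn.1, act (b.U i) (yhat - u), ?_, ?_⟩
  · rw [norm_act_U]
    have h1 : ‖xnext - x‖ ^ 2 ≤ ‖d‖ ^ 2 := pow_le_pow_left₀ (norm_nonneg _) hn.2.1 2
    have h2 : p.σ * lmin / K * (‖xnext - x‖ ^ 2 + ‖yhat - u‖ ^ 2) ≤ p.σ * l * -Ht := by
      have hσ0 := hσ.1
      calc _ ≤ p.σ * lmin / K * (K * -Ht) :=
            mul_le_mul_of_nonneg_left (by linarith) (by positivity)
        _ = p.σ * lmin * -Ht := by field_simp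
        _ ≤ _ := mul_le_mul_of_nonneg_right (mul_le_mul_of_nonneg_left hlm hσ0.le)
          (by linarith)
    linarith [hn.2.2]
  · have h1 := norm_block_gradient_le hα0 hs.β_mem.1 hμ hs.D_posDef h0 hs.D_upper
      a3.contDiff_phi hmin
    rw [norm_act_U]
    refine h1.trans (add_le_add_left ?_ _)
    have n1 : β / α ≤ p.βmax / p.αmin := by
      have := hs.β_mem.2
      have := hs.α_mem.1
      gcongr
    have n2 : 1 / α ≤ 1 / p.αmin := by
      have := hs.α_mem.1
      gcongr
    rw [← hu]
    set V := ‖act (b.U i)ᵀ (x - w)‖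
    have hV : 0 ≤ V := norm_nonneg _
    have hZ := norm_nonneg (yhat - u)
    have m1 : β / α * p.μ * V ≤ p.βmax / p.αmin * p.μ * V := by gcongr
    have m2 : 1 / α * p.μ * ‖yhat - u‖ ≤ 1 / p.αmin * p.μ * ‖yhat - u‖ := by gcongr
    have m3 : 0 ≤ p.βmax / p.αmin * p.μ * ‖yhat - u‖ := by positivity
    have m4 : 0 ≤ 1 / p.αmin * p.μ * V := by positivity
    linarith

end Step

/-! ### Gradients of `F` and of the surrogate. -/

section Surrogate

variable {n : ℕ}

/-- Stated for arbitrary continuous linear maps so that the chain rule needs no coordinates of the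
product; the two projections are substituted afterwards. The `+ 1` only keeps the constant positive.
-/
lemma norm_gradient_comp_add_sq_le {V : Type*} [NormedAddCommGroup V] [InnerProductSpace ℝ V]
    [CompleteSpace V] {F : E n → ℝ} (hF : ContDiff ℝ 1 F) (p₁ : V →L[ℝ] E n) (p₂ : V →L[ℝ] ℝ)
    (z : V) :
    ‖gradient (fun z => F (p₁ z) + 1 / 2 * p₂ z ^ 2) z‖ ≤
      (‖p₁‖ + ‖p₂‖ + 1) * (‖gradient F (p₁ z)‖ + |p₂ z|) := by
  have h1 : HasFDerivAt F (fderiv ℝ F (p₁ z)) (p₁ z) :=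
    ((hF.differentiable one_ne_zero) _).hasFDerivAt
  have h2 : HasFDerivAt (fun z => F (p₁ z) + 1 / 2 * p₂ z ^ 2)
      ((fderiv ℝ F (p₁ z)).comp p₁ + p₂ z • p₂) z := by
    refine ((h1.comp z p₁.hasFDerivAt).add
      (((p₂.hasFDerivAt (x := z)).pow 2).const_mul (1 / 2))).congr_fderiv ?_
    ext w
    simp
    ring
  have e1 : ‖gradient (fun z => F (p₁ z) + 1 / 2 * p₂ z ^ 2) z‖ =
      ‖(fderiv ℝ F (p₁ z)).comp p₁ + p₂ z • p₂‖ := by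
    rw [← h2.fderiv]; exact LinearIsometryEquiv.norm_map _ _
  have e2 : ‖gradient F (p₁ z)‖ = ‖fderiv ℝ F (p₁ z)‖ := LinearIsometryEquiv.norm_map _ _
  rw [e1, e2]
  have n1 := (fderiv ℝ F (p₁ z)).opNorm_comp_le p₁
  have n2 := norm_add_le ((fderiv ℝ F (p₁ z)).comp p₁) (p₂ z • p₂)
  rw [norm_smul, Real.norm_eq_abs] at n2
  have m1 := mul_nonneg (norm_nonneg p₁) (abs_nonneg (p₂ z))
  have m2 := mul_nonneg (norm_nonneg p₂) (norm_nonneg (fderiv ℝ F (p₁ z)))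
  have m3 := norm_nonneg (fderiv ℝ F (p₁ z))
  have m4 := abs_nonneg (p₂ z)
  linarith

lemma norm_gradient_surrogate_le {F : E n → ℝ} (hF : ContDiff ℝ 1 F) :
    ∃ C > 0, ∀ z : WithLp 2 (E n × ℝ),
      ‖gradient (surrogate F) z‖ ≤ C * (‖gradient F z.fst‖ + |z.snd|) :=
  ⟨‖WithLp.fstL 2 ℝ (E n) ℝ‖ + ‖WithLp.sndL 2 ℝ (E n) ℝ‖ + 1, by positivity, fun z =>
    norm_gradient_comp_add_sq_le hF (WithLp.fstL 2 ℝ (E n) ℝ) (WithLp.sndL 2 ℝ (E n) ℝ) z⟩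

lemma continuous_gradient {F : E n → ℝ} (hF : ContDiff ℝ 1 F) : Continuous (gradient F) :=
  (LinearIsometryEquiv.continuous _).comp (hF.continuous_fderiv one_ne_zero)

lemma gradient_add_of_contDiff {f φ : E n → ℝ} (hf : ContDiff ℝ 1 f) (hφ : ContDiff ℝ 1 φ)
    (x : E n) : gradient (fun y => f y + φ y) x = gradient f x + gradient φ x :=
  HasGradientAt.gradient (by
    have h1 := ((hf.differentiable one_ne_zero) x).hasGradientAt.hasFDerivAt
    have h2 := ((hφ.differentiable one_ne_zero) x).hasGradientAt.hasFDerivAt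
    have h3 := h1.add h2
    rw [← map_add] at h3
    exact h3)

end Surrogate

/-! ### Arithmetic of the cyclic block selection. -/

section Cyclic

lemma exists_add_mod_eq {N : ℕ} (k : ℕ) {i : ℕ} (hi : i < N) : ∃ j < N, (k + j) % N = i := by
  have hk := Nat.div_add_mod k N
  have hlt := Nat.mod_lt k (Nat.zero_lt_of_lt hi)
  rcases le_or_gt (k % N) i with h | h
  · refine ⟨i - k % N, by omega, ?_⟩
    rw [show k + (i - k % N) = i + N * (k / N) by omega, Nat.add_mul_mod_self_left,
      Nat.mod_eq_of_lt hi]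
  · refine ⟨N + i - k % N, by omega, ?_⟩
    rw [show k + (N + i - k % N) = i + N * (k / N + 1) by rw [mul_add]; omega,
      Nat.add_mul_mod_self_left, Nat.mod_eq_of_lt hi]

lemma ofNat_ne_ofNat_add {N : ℕ} [NeZero N] (k : ℕ) {j : ℕ} (hj0 : 0 < j) (hj : j < N) :
    Fin.ofNat N k ≠ Fin.ofNat N (k + j) := by
  intro h
  have h1 : k % N = (k + j) % N := congrArg Fin.val h
  have h2 : (k + j) ≡ k + 0 [MOD N] := h1.symm
  have h3 : j ≡ 0 [MOD N] := Nat.ModEq.add_left_cancel' k h2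
  rw [Nat.modEq_zero_iff_dvd] at h3
  exact absurd (Nat.le_of_dvd hj0 h3) (not_le.2 hj)

/-- Between two visits of a block its coordinates change only once. -/
lemma norm_block_sub_le {n N : ℕ} [NeZero N] (b : BlockDecomposition n N) {x : ℕ → E n}
    (hx : ∀ k, ∃ d, x (k + 1) = x k + act (b.U (Fin.ofNat N k)) d) (k : ℕ) :
    ‖act (b.U (Fin.ofNat N (k + N)))ᵀ (x (k + N) - x k)‖ ≤ ‖x (k + 1) - x k‖ := by
  have hi : Fin.ofNat N (k + N) = Fin.ofNat N k := Fin.ext (by simp [Fin.ofNat])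
  rw [hi]
  have h : ∀ j, j < N → act (b.U (Fin.ofNat N k))ᵀ (x (k + j + 1)) =
      act (b.U (Fin.ofNat N k))ᵀ (x (k + 1)) := by
    intro j
    induction j with
    | zero => intro _; rfl
    | succ j ih =>
      intro hj
      obtain ⟨d, hd⟩ := hx (k + (j + 1))
      rw [hd, act_add, act_transpose_U_act_U_of_ne b (ofNat_ne_ofNat_add k (Nat.succ_pos j) hj),
        add_zero]
      exact ih (by omega)
  have hN : 0 < N := Nat.pos_of_ne_zero (NeZero.ne N)
  have h1 := h (N - 1) (by omega)
  rw [show k + (N - 1) + 1 = k + N by omega] at h1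
  rw [act_sub, h1, ← act_sub]
  exact norm_act_transpose_U_le b _ _

end Cyclic

/-! ### The Lyapunov function and convergence of the iterates. -/

section Convergence

variable {n N : ℕ} [NeZero N]

/-- The quantitative content of the boundedness of the iterates: a Lyapunov function `Φ` whose
decrease `e ^ 2` controls the steps and the gradients. -/
lemma exists_lyapunov (b : BlockDecomposition n N) {f φ : E n → ℝ}
    (a1 : Assumption1 b f φ) (a2 : Assumption2 f) (a3 : Assumption3 φ) (p : Params)
    {x : ℕ → E n} (hx : IsGenerated f φ b p x) (hbdd : Bornology.IsBounded (range x)) :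
    ∃ e ρ : ℕ → ℝ, ∃ c ≥ 0, ∃ C ≥ 0, (∀ k, 0 ≤ e k) ∧ (∀ k, 0 ≤ ρ k) ∧
      (∀ k, dist (x (k + N)) (x (k + 1 + N)) ≤ c * e k) ∧
      (∀ k, (f (x (k + N)) + φ (x (k + N)) + 1 / 2 * ρ k ^ 2) -
        (f (x (k + 1 + N)) + φ (x (k + 1 + N)) + 1 / 2 * ρ (k + 1) ^ 2) = e k ^ 2) ∧
      ∀ k, ‖gradient (fun y => f y + φ y) (x (k + 2 * N + N))‖ + ρ (k + 2 * N)
        ≤ C * ∑ j ∈ Finset.range (2 * N), e (k + j) := by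
  have hN : 0 < N := Nat.pos_of_ne_zero (NeZero.ne N)
  have hγ := p.γ_pos
  obtain ⟨L, hL, hlip⟩ := a2
  obtain ⟨a, ha, C₀, hC₀, hstep⟩ := exists_decrease_and_gradient_bound (p := p) a1 a3 hL hlip
  obtain ⟨Flow, hFlow⟩ := a1.bounded_below
  have hdata : ∀ k, (∃ d, x (k + 1) = x k + act (b.U (Fin.ofNat N k)) d) ∧ ∃ z : E n,
      (f (x (k + 1)) + φ (x (k + 1))) + p.γ / 2 * ‖x (k + 1) - x k‖ ^ 2
        + a * (‖x (k + 1) - x k‖ ^ 2 + ‖z‖ ^ 2)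
        ≤ (f (x k) + φ (x k)) + p.γ / 2 * ‖act (b.U (Fin.ofNat N k))ᵀ (x k - x (k - N))‖ ^ 2 ∧
      ‖act (b.U (Fin.ofNat N k))ᵀ (gradient f (x k) + gradient φ (x k))‖ ≤
        C₀ * (‖act (b.U (Fin.ofNat N k))ᵀ (x k - x (k - N))‖ + ‖z‖)
          + ‖gradient φ (x k + z) - gradient φ (x k)‖ := by
    intro k
    obtain ⟨α, β, D, ytilde, m, hs⟩ := hx k
    exact hstep _ _ _ _ _ _ _ _ _ hs
  choose hd z hdec hgrad using hdata
  set s : ℕ → ℝ := fun k => ‖x (k + 1) - x k‖ with hs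
  have hs0 : ∀ k, 0 ≤ s k := fun k => norm_nonneg _
  have hv : ∀ k, ‖act (b.U (Fin.ofNat N (k + N)))ᵀ (x (k + N) - x (k + N - N))‖ ≤ s k := by
    intro k
    rw [Nat.add_sub_cancel]
    exact norm_block_sub_le b hd k
  -- Chosen so that `ρ² / 2` is `γ / 2` times the `N` squared steps leading to `x (k + N)`. Shifting
  -- by `N` avoids the truncated initial indices.
  set ρ : ℕ → ℝ := fun k => √(p.γ * ∑ j ∈ Finset.range N, s (k + j) ^ 2) with hρ
  have hρ0 : ∀ k, 0 ≤ ρ k := fun k => Real.sqrt_nonneg _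
  have hρsq : ∀ k, ρ k ^ 2 = p.γ * ∑ j ∈ Finset.range N, s (k + j) ^ 2 := fun k =>
    Real.sq_sqrt (mul_nonneg hγ.le (Finset.sum_nonneg fun _ _ => sq_nonneg _))
  set Φ : ℕ → ℝ := fun k => f (x (k + N)) + φ (x (k + N)) + 1 / 2 * ρ k ^ 2 with hΦ
  have hΦdec : ∀ k, a * (s (k + N) ^ 2 + ‖z (k + N)‖ ^ 2) ≤ Φ k - Φ (k + 1) := by
    intro k
    have h1 := hdec (k + N)
    have h2 := pow_le_pow_left₀ (norm_nonneg _) (hv k) 2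
    have h3 := mul_le_mul_of_nonneg_left h2 (by positivity : 0 ≤ p.γ / 2)
    -- Sliding the window trades `s k` for `s (k + N)`, precisely the two `γ` terms of the decrease.
    have h4 : ∑ j ∈ Finset.range N, s (k + 1 + j) ^ 2 + s k ^ 2 =
        ∑ j ∈ Finset.range N, s (k + j) ^ 2 + s (k + N) ^ 2 := by
      rw [← Finset.sum_range_succ (fun j => s (k + j) ^ 2), Finset.sum_range_succ']
      simp only [add_zero]
      congr 1
      exact Finset.sum_congr rfl fun j _ => by congr 2; omega
    simp only [hΦ, hρsq]
    rw [show k + N + 1 = k + 1 + N by omega] at h1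
    have h5 : ‖x (k + 1 + N) - x (k + N)‖ = s (k + N) := by
      rw [hs]; simp only; congr 3; omega
    rw [h5] at h1
    have h6 := congrArg (fun t => p.γ / 2 * t) h4
    simp only [mul_add] at h6
    linarith
  set e : ℕ → ℝ := fun k => √(Φ k - Φ (k + 1)) with he
  have hΦ0 : ∀ k, 0 ≤ Φ k - Φ (k + 1) := fun k => le_trans (by positivity) (hΦdec k)
  have he0 : ∀ k, 0 ≤ e k := fun k => Real.sqrt_nonneg _
  have hesq : ∀ k, e k ^ 2 = Φ k - Φ (k + 1) := fun k => Real.sq_sqrt (hΦ0 k)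
  set c : ℝ := 1 / √a with hc
  have hsa : 0 < √a := Real.sqrt_pos.2 ha
  have hc0 : 0 < c := by positivity
  have hce : ∀ {t : ℝ} {k : ℕ}, 0 ≤ t → a * t ^ 2 ≤ e k ^ 2 → t ≤ c * e k := by
    intro t k ht h
    have h1 : (√a * t) ^ 2 ≤ e k ^ 2 := by rwa [mul_pow, Real.sq_sqrt ha.le]
    have h2 := (abs_le_of_sq_le_sq' h1 (he0 k)).2
    rw [hc, div_mul_eq_mul_div, one_mul, le_div_iff₀ hsa]
    linarith
  have hse : ∀ k, s (k + N) ≤ c * e k := fun k => hce (hs0 _) (by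
    rw [hesq]; exact le_trans (mul_le_mul_of_nonneg_left (by simp) ha.le) (hΦdec k))
  have hze : ∀ k, ‖z (k + N)‖ ≤ c * e k := fun k => hce (norm_nonneg _) (by
    rw [hesq]; exact le_trans (mul_le_mul_of_nonneg_left (by simp [sq_nonneg]) ha.le) (hΦdec k))
  have hdist : ∀ k, dist (x (k + N)) (x (k + 1 + N)) ≤ c * e k := by
    intro k
    rw [dist_comm, dist_eq_norm, show k + 1 + N = k + N + 1 by omega]
    exact hse k
  -- local Lipschitz continuity of the gradients on a ball containing all the relevant points
  have hanti : Antitone Φ := antitone_nat_of_succ_le fun k => by linarith [hΦ0 k]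
  have hΦlow : ∀ k, Flow ≤ Φ k := fun k => by
    have := hFlow (x (k + N))
    have := sq_nonneg (ρ k)
    simp only [hΦ]; linarith
  obtain ⟨R, hR⟩ := hbdd.exists_norm_le
  have hR' : ∀ k, ‖x k‖ ≤ R := fun k => hR _ (mem_range_self k)
  -- No decrease exceeds `Φ 0 - Flow`, so the points `x + z` also stay in a fixed ball, where `∇φ`
  -- is Lipschitz.
  set R₁ := c * √(Φ 0 - Flow) with hR₁
  have hzR : ∀ k, ‖z (k + N)‖ ≤ R₁ := fun k => (hze k).trans
    (mul_le_mul_of_nonneg_left (Real.sqrt_le_sqrt (by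
      linarith [hanti (Nat.zero_le k), hΦlow (k + 1)])) hc0.le)
  have hR₁0 : 0 ≤ R₁ := by positivity
  obtain ⟨L', hL', hlip'⟩ := a3.locally_lipschitz _ (isCompact_closedBall (0 : E n) (R + R₁))
  have hmem : ∀ k, x k ∈ Metric.closedBall (0 : E n) (R + R₁) := fun k => by
    rw [mem_closedBall_zero_iff]; linarith [hR' k]
  set g : E n → E n := gradient (fun y => f y + φ y) with hg
  have hgeq : ∀ y, g y = gradient f y + gradient φ y :=
    gradient_add_of_contDiff a1.contDiff_f a3.contDiff_phi
  have hglip : ∀ k l, ‖g (x k) - g (x l)‖ ≤ (L + L') * ‖x k - x l‖ := by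
    intro k l
    have h1 := hlip (x k) (x l)
    have h2 := hlip' _ (hmem k) _ (hmem l)
    have h3 := norm_add_le (gradient f (x k) - gradient f (x l))
      (gradient φ (x k) - gradient φ (x l))
    rw [hgeq, hgeq, show gradient f (x k) + gradient φ (x k) - (gradient f (x l) +
      gradient φ (x l)) = (gradient f (x k) - gradient f (x l)) +
      (gradient φ (x k) - gradient φ (x l)) by abel]
    linarith
  have hblock : ∀ k, ‖act (b.U (Fin.ofNat N (k + N)))ᵀ (g (x (k + N)))‖ ≤
      C₀ * s k + (C₀ + L') * c * e k := by
    intro k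
    have h1 := hgrad (k + N)
    rw [← hgeq] at h1
    have h2 := hlip' (x (k + N) + z (k + N)) (by
      rw [mem_closedBall_zero_iff]
      exact (norm_add_le _ _).trans (add_le_add (hR' _) (hzR k))) _ (hmem (k + N))
    rw [add_sub_cancel_left] at h2
    have h3 := mul_le_mul_of_nonneg_left (hze k) (by positivity : 0 ≤ C₀ + L')
    have h4 := mul_le_mul_of_nonneg_left (hv k) hC₀.le
    linarith
  set W : ℕ → ℝ := fun k => ∑ j ∈ Finset.range (2 * N), e (k + j) with hW
  have hW0 : ∀ k, 0 ≤ W k := fun k => Finset.sum_nonneg fun _ _ => he0 _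
  have heW : ∀ k j, j < 2 * N → e (k + j) ≤ W k := fun k j hj =>
    Finset.single_le_sum (f := fun j => e (k + j)) (fun _ _ => he0 _) (Finset.mem_range.2 hj)
  set A := C₀ * c + (C₀ + L') * c + (L + L') * c with hA
  have hA0 : 0 ≤ A := by positivity
  have hgi : ∀ k (i : Fin N), ‖act (b.U i)ᵀ (g (x (k + 2 * N + N)))‖ ≤ A * W k := by
    intro k i
    -- Block `i` is active at iteration `k + 2N + j`. Its gradient bound there involves `e (k + N +
    -- j)` and a step bounded by `e (k + j)`, whence the window of length `2N`. Lipschitz continuity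
    -- carries it to `x (k + 3N)`.
    obtain ⟨j, hj, hji⟩ := exists_add_mod_eq (k + N + N) i.2
    have hi : i = Fin.ofNat N (k + N + j + N) := Fin.ext (by
      rw [← hji]; simp only [Fin.ofNat]; congr 1; omega)
    have h1 := hblock (k + N + j)
    rw [← hi] at h1
    have h2 : s (k + N + j) ≤ c * W k := by
      rw [show k + N + j = k + j + N by omega]
      exact (hse _).trans (mul_le_mul_of_nonneg_left (heW k j (by omega)) hc0.le)
    have h3 : e (k + N + j) ≤ W k := by
      rw [show k + N + j = k + (N + j) by omega]
      exact heW k _ (by omega)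
    have h4 : ‖x (k + 2 * N + N) - x (k + N + j + N)‖ ≤ c * W k := by
      rw [← dist_eq_norm, dist_comm]
      have h5 := dist_le_Ico_sum_of_dist_le (f := fun k => x (k + N)) (d := fun k => c * e k)
        (show k + N + j ≤ k + 2 * N by omega) (fun {m} _ _ => hdist m)
      refine h5.trans ?_
      rw [← Finset.mul_sum]
      refine mul_le_mul_of_nonneg_left ?_ hc0.le
      have h6 : W k = ∑ m ∈ Finset.Ico k (k + 2 * N), e m := by
        rw [Finset.sum_Ico_eq_sum_range, Nat.add_sub_cancel_left]
      rw [h6]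
      exact Finset.sum_le_sum_of_subset_of_nonneg
        (Finset.Ico_subset_Ico (by omega) le_rfl) fun _ _ _ => he0 _
    have h5 := (norm_act_transpose_U_le b i
      (g (x (k + 2 * N + N)) - g (x (k + N + j + N)))).trans (hglip _ _)
    rw [act_sub] at h5
    have h6 := norm_le_norm_sub_add (act (b.U i)ᵀ (g (x (k + 2 * N + N))))
      (act (b.U i)ᵀ (g (x (k + N + j + N))))
    have h7 := mul_le_mul_of_nonneg_left h4 (by positivity : 0 ≤ L + L')
    have h8 := mul_le_mul_of_nonneg_left h2 hC₀.le
    have h9 := mul_le_mul_of_nonneg_left h3 (by positivity : 0 ≤ (C₀ + L') * c)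
    rw [hA]
    linarith
  have hgW : ∀ k, ‖g (x (k + 2 * N + N))‖ ≤ N * A * W k := by
    intro k
    refine (norm_le_sum_blocks b _).trans ((Finset.sum_le_card_nsmul _ _ _
      fun i _ => hgi k i).trans_eq ?_)
    simp [mul_assoc]
  have hρW : ∀ k, ρ (k + 2 * N) ≤ √p.γ * c * W k := by
    intro k
    rw [hρ]
    simp only
    rw [Real.sqrt_mul hγ.le, mul_assoc]
    refine mul_le_mul_of_nonneg_left ?_ (Real.sqrt_nonneg _)
    refine Real.sqrt_le_iff.2 ⟨by have := hW0 k; positivity, ?_⟩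
    refine (Finset.sum_sq_le_sq_sum_of_nonneg fun _ _ => hs0 _).trans
      (pow_le_pow_left₀ (Finset.sum_nonneg fun _ _ => hs0 _) ?_ 2)
    have h1 : ∑ j ∈ Finset.range N, s (k + 2 * N + j) ≤
        ∑ j ∈ Finset.range N, c * e (k + (N + j)) := Finset.sum_le_sum fun j _ => by
      rw [show k + 2 * N + j = k + (N + j) + N by omega]; exact hse _
    refine h1.trans ?_
    rw [← Finset.mul_sum]
    refine mul_le_mul_of_nonneg_left ?_ hc0.le
    simp only [hW, two_mul]
    rw [Finset.sum_range_add]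
    exact le_add_of_nonneg_left (Finset.sum_nonneg fun _ _ => he0 _)
  refine ⟨e, ρ, c, hc0.le, N * A + √p.γ * c, by positivity, he0, hρ0, hdist,
    fun k => (hesq k).symm, fun k => ?_⟩
  have := hgW k
  have := hρW k
  rw [add_mul]
  linarith

/-- Convergence of a sequence whose surrogate values decrease sufficiently, for a surrogate with
the Kurdyka–Łojasiewicz property. -/
lemma exists_tendsto_of_isKL {F : E n → ℝ} (hF : ContDiff ℝ 1 F) {Flow : ℝ}
    (hlow : ∀ y, Flow ≤ F y) (hKL : IsKL (surrogate F)) {y : ℕ → E n}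
    (hbdd : Bornology.IsBounded (range y)) {e ρ : ℕ → ℝ} {c C : ℝ} {M : ℕ} (hM : 0 < M)
    (hc : 0 ≤ c) (hC : 0 ≤ C) (he0 : ∀ k, 0 ≤ e k) (hρ0 : ∀ k, 0 ≤ ρ k)
    (hy : ∀ k, dist (y k) (y (k + 1)) ≤ c * e k)
    (hdec : ∀ k, (F (y k) + 1 / 2 * ρ k ^ 2) - (F (y (k + 1)) + 1 / 2 * ρ (k + 1) ^ 2) = e k ^ 2)
    (hgrad : ∀ k, ‖gradient F (y (k + M))‖ + ρ (k + M) ≤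
      C * ∑ j ∈ Finset.range M, e (k + j)) :
    ∃ a, Tendsto y atTop (𝓝 a) ∧ gradient F a = 0 := by
  set Φ : ℕ → ℝ := fun k => F (y k) + 1 / 2 * ρ k ^ 2 with hΦ
  have hanti : Antitone Φ := antitone_nat_of_succ_le fun k => by
    have := hdec k
    have := sq_nonneg (e k)
    simp only [hΦ]; linarith
  have hbelow : BddBelow (range Φ) := ⟨Flow, by
    rintro _ ⟨k, rfl⟩
    have := hlow (y k)
    have := sq_nonneg (ρ k)
    simp only [hΦ]; linarith⟩
  set Φs := ⨅ k, Φ k with hΦs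
  have hΦt : Tendsto Φ atTop (𝓝 Φs) := tendsto_atTop_ciInf hanti hbelow
  have hrt : Tendsto (fun k => Φ k - Φs) atTop (𝓝 0) := by
    simpa using hΦt.sub_const Φs
  have het : Tendsto e atTop (𝓝 0) := by
    have h1 : Tendsto (fun k => e k ^ 2) atTop (𝓝 0) := by
      have := hΦt.sub (hΦt.comp (tendsto_add_atTop_nat 1))
      rw [sub_self] at this
      exact this.congr hdec
    simpa [Real.sqrt_sq (he0 _)] using h1.sqrt
  have hWt : Tendsto (fun k => C * ∑ j ∈ Finset.range M, e (k + j)) atTop (𝓝 0) := by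
    have h1 : Tendsto (fun k => ∑ j ∈ Finset.range M, e (k + j)) atTop (𝓝 0) := by
      simpa using tendsto_finsetSum (Finset.range M)
        fun j _ => het.comp (tendsto_add_atTop_nat j)
    simpa using h1.const_mul C
  have hρt : Tendsto ρ atTop (𝓝 0) := by
    rw [← tendsto_add_atTop_iff_nat M]
    exact squeeze_zero (fun k => hρ0 _)
      (fun k => (le_add_of_nonneg_left (norm_nonneg _)).trans (hgrad k)) hWt
  have hgt : Tendsto (fun k => gradient F (y k)) atTop (𝓝 0) := by
    rw [← tendsto_add_atTop_iff_nat M]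
    exact squeeze_zero_norm (fun k => (le_add_of_nonneg_right (hρ0 _)).trans (hgrad k)) hWt
  have hFt : Tendsto (fun k => F (y k)) atTop (𝓝 Φs) := by
    have := hΦt.sub ((hρt.pow 2).const_mul (1 / 2))
    simpa [hΦ] using this
  obtain ⟨R, hR⟩ := hbdd.exists_norm_le
  obtain ⟨a, -, ha⟩ := (isCompact_closedBall (0 : E n) R).exists_mapClusterPt (f := atTop)
    (u := y) (le_principal_iff.2 (mem_map.2 (univ_mem' fun k => by
      rw [mem_preimage, mem_closedBall_zero_iff]; exact hR _ (mem_range_self k))))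
  -- Since `ρ` vanishes in the limit, the surrogate at `(a, 0)` equals the limit of `Φ`, so the KL
  -- gap there is `Φ k - Φs`.
  have hFa : F a = Φs := by
    have h1 : MapClusterPt (F a) atTop (F ∘ y) := ha.continuousAt_comp hF.continuous.continuousAt
    exact eq_of_nhds_neBot (h1.clusterPt.mono hFt)
  obtain ⟨ν, hν, V, hV, ξ, hξc, hξ, hξ0, hξz, hξd, hξpos, hineq⟩ :=
    hKL.2 (WithLp.toLp 2 (a, (0 : ℝ)))
  obtain ⟨C₁, hC₁, hsur⟩ := norm_gradient_surrogate_le hF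
  have hcont : ContinuousAt (fun q : E n × ℝ => WithLp.toLp 2 q) (a, 0) :=
    (WithLp.prod_continuous_toLp 2 (E n) ℝ).continuousAt
  -- As `ρ` tends to zero, only the first coordinate has to be kept near `a`.
  obtain ⟨V₁, hV₁, V₂, hV₂, hVV⟩ := mem_nhds_prod_iff.1 (hcont hV)
  obtain ⟨ε, hε, hball⟩ := Metric.mem_nhds_iff.1 hV₁
  have hsa : surrogate F (WithLp.toLp 2 (a, (0 : ℝ))) = Φs := by simp [surrogate, hFa]
  have hsum : Summable e := by
    refine summable_of_desingularization (r := fun k => Φ k - Φs) (C := C₁ * C) (M := M) hM hc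
      (by positivity) hε hν ha (fun k => sub_nonneg.2 (hanti.le_of_tendsto hΦt k)) hrt he0
      (fun k => by rw [← hdec k]; simp only [hΦ]; ring) hy hξc hξ hξ0 hξz
      (hξd.differentiableOn one_ne_zero) hξpos ?_
    have hρV := (tendsto_add_atTop_nat M).eventually (hρt.eventually hV₂)
    filter_upwards [hρV] with k hk hd hmem
    have hq : WithLp.toLp 2 (y (k + M), ρ (k + M)) ∈ V :=
      hVV (mk_mem_prod (hball hd) hk)
    have hval : surrogate F (WithLp.toLp 2 (y (k + M), ρ (k + M))) = Φ (k + M) := rfl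
    have h1 := hineq _ hq
    rw [hsa, hval] at h1
    refine (h1 (by linarith [hmem.1]) (by linarith [hmem.2])).trans
      (mul_le_mul_of_nonneg_left ?_ (hξpos _ hmem).le)
    refine (hsur _).trans ?_
    rw [mul_assoc]
    refine mul_le_mul_of_nonneg_left ?_ hC₁.le
    simpa [abs_of_nonneg (hρ0 (k + M))] using hgrad k
  obtain ⟨xs, hxs⟩ := cauchySeq_tendsto_of_complete
    (cauchySeq_of_dist_le_of_summable _ hy (hsum.mul_left c))
  exact ⟨xs, hxs, tendsto_nhds_unique (((continuous_gradient hF).tendsto xs).comp hxs) hgt⟩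

end Convergence

end BlockPHILA

theorem mainTheorem2 {n N : ℕ} [NeZero N] (b : BlockPHILA.BlockDecomposition n N)
    (f φ : BlockPHILA.E n → ℝ)
    (h1 : BlockPHILA.Assumption1 b f φ) (h2 : BlockPHILA.Assumption2 f)
    (h3 : BlockPHILA.Assumption3 φ)
    (p : BlockPHILA.Params) (x : ℕ → BlockPHILA.E n)
    (hx : BlockPHILA.IsGenerated f φ b p x)
    (hbdd : Bornology.IsBounded (Set.range x))
    (hKL : BlockPHILA.IsKL (BlockPHILA.surrogate (fun y => f y + φ y))) :
    ∃ xstar : BlockPHILA.E n, Filter.Tendsto x Filter.atTop (nhds xstar) ∧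
      HasGradientAt (fun y => f y + φ y) 0 xstar := by
  have hF : ContDiff ℝ 1 (fun y => f y + φ y) := h1.contDiff_f.add h3.contDiff_phi
  obtain ⟨Flow, hFlow⟩ := h1.bounded_below
  obtain ⟨e, ρ, c, hc, C, hC, he0, hρ0, hdist, hdec, hgrad⟩ :=
    BlockPHILA.exists_lyapunov b h1 h2 h3 p hx hbdd
  have hN : 0 < 2 * N := Nat.mul_pos two_pos (Nat.pos_of_ne_zero (NeZero.ne N))
  obtain ⟨a, ha, hga⟩ := BlockPHILA.exists_tendsto_of_isKL hF hFlow hKL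
    (y := fun k => x (k + N))
    (hbdd.subset (Set.range_subset_iff.2 fun k => Set.mem_range_self _)) hN hc hC he0 hρ0 hdist
    hdec hgrad
  refine ⟨a, (Filter.tendsto_add_atTop_iff_nat N).1 ha, ?_⟩
  rw [← hga]
  exact ((hF.differentiable one_ne_zero) a).hasGradientAt
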